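/- A \emph{contact relation} on a Boolean algebra $B$ is a binary relation $\rho$ such that: $a\neq 0$ implies $a\rho a$; $a\rho b$ implies $a\neq 0$ and $b\neq 0$; $a\rho b$ implies $b\rho a$; $a\rho(b\vee c)$ iff $a\rho b$ or $a\rho c$. Write $a\ll_\rho b$ if not $a\rho b^*$, where ${}^*$ is the complement. A \emph{complete local contact algebra} $(B,\rho,\mathbb B)$ is a complete Boolean algebra $B$ ($0=1$ is allowed) with a contact relation $\rho$ and a subset $\mathbb B\subseteq B$ such that: $0\in\mathbb B$; $a\le b\in\mathbb B$ implies $a\in\mathbb B$; $a,b\in\mathbb B$ implies $a\vee b\in\mathbb B$; if $a\in\mathbb B$ and $a\ll_\rho c$, then $a\ll_\rho b\ll_\rho c$ for some $b\in\mathbb B$; if $a\rho b$, then $a\rho(c\wedge b)$ for some $c\in\mathbb B$; if $a\ne 0$, then $b\ll_\rho a$ for some $b\in\mathbb B\setminus\{0\}$. A \emph{complete MVD-algebra} $(B,\le,\ll)$ is a complete Boolean algebra $(B,\le)$ ($0=1$ is allowed) with a binary relation $\ll$ such that: $a\ll b$ implies $a\le b$; $0\ll 0$; $a\le b\ll c\le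 t$ implies $a\ll t$; $a\ll c$ and $b\ll c$ imply $a\vee b\ll c$; $a\ll b$ and $a\ll c$ imply $a\ll b\wedge c$; $a\ll c$ implies $a\ll b\ll c$ for some $b$; if $a\neq 0$, then $b\ll a$ for some $b\neq 0$; if $a\ll 1$ and $b^*\ll a^*$, then $a\ll b$. A \emph{complete Boolean homomorphism} is a map $\varphi:A\to B$ of complete Boolean algebras that preserves all joins and meets; $\varphi_\Lambda:B\to A$ denotes its lower adjoint: $\varphi_\Lambda(b)\le a$ iff $b\le\varphi(a)$. Let $\mathbf{SOAL}$ be the category of complete local contact algebras whose morphisms $(A,\rho,\mathbb B)\to(B,\eta,\mathbb B')$ are the surjective complete Boolean homomorphisms $\varphi:A\to B$ such that (L1) for all $a,b\in A$, $\varphi(a)\eta\varphi(b)$ implies $a\rho b$; (L2) $b\in\mathbb B'$ implies $\varphi_\Lambda(b)\in\mathbb B$; (LO) for all $a\in A$ and $b\in\mathbb B'$, $\varphi_\Lambda(b)\rho a$ implies $b\eta\varphi(a)$. Let $\mathbf{ISOAL}$ be the category of complete MVD-algebras whose morphisms $(B,\le,\ll)\to(B',\le',\ll')$ are the surjective complete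 Boolean homomorphisms $\varphi:B\to B'$ such that (S1) for all $a,b\in B$, if $c\wedge a\ll c^*\vee b$ for every $c\in B$ with $c\ll 1$, then $d\wedge\varphi(a)\ll' d^*\vee\varphi(b)$ for every $d\in B'$ with $d\ll' 1$; (S2) for all $b\in B'$, $b\ll' 1$ implies $\varphi_\Lambda(b)\ll 1$; (SO) for all $a\in B$ and $b\in B'$, $b\ll'\varphi(a)$ implies $\varphi_\Lambda(b)\ll a$. Let $\mathbf{IOLC}$ be the category of locally compact Hausdorff spaces and injective open continuous maps. Composition in all three categories is composition of functions. \textbf{Theorem.} The categories $\mathbf{SOAL}$ and $\mathbf{ISOAL}$ are isomorphic; hence the categories $\mathbf{IOLC}$ and $\mathbf{ISOAL}$ are dually equivalent. -/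

import Mathlib

open CategoryTheory

universe u

/-! ### Contact relations, local contact algebras and MVD-algebras -/

/-- A contact relation `C` on a Boolean algebra. -/
structure IsContactRelation {B : Type u} [BooleanAlgebra B] (C : B → B → Prop) : Prop where
  refl_of_ne_bot : ∀ a, a ≠ ⊥ → C a a
  ne_bot : ∀ a b, C a b → a ≠ ⊥ ∧ b ≠ ⊥
  symm : ∀ a b, C a b → C b a
  sup_iff : ∀ a b c, C a (b ⊔ c) ↔ C a b ∨ C a c

/-- Non-tangential inclusion: `a ≪_C b` iff `a` is not in contact with the complement of `b`. -/
def NonTangential {B : Type u} [BooleanAlgebra B] (C : B → B → Prop) (a b : B) : Prop :=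
  ¬ C a bᶜ

/-- `(B, ρ, 𝔹)` is a local contact algebra, `𝔹` being the set of bounded elements. -/
structure IsLocalContact {B : Type u} [BooleanAlgebra B] (ρ : B → B → Prop) (𝔹 : Set B) :
    Prop where
  contact : IsContactRelation ρ
  bot_mem : ⊥ ∈ 𝔹
  mem_of_le : ∀ a b, a ≤ b → b ∈ 𝔹 → a ∈ 𝔹
  sup_mem : ∀ a b, a ∈ 𝔹 → b ∈ 𝔹 → a ⊔ b ∈ 𝔹
  interpolate : ∀ a c, a ∈ 𝔹 → NonTangential ρ a c →
    ∃ b ∈ 𝔹, NonTangential ρ a b ∧ NonTangential ρ b c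
  contact_bounded : ∀ a b, ρ a b → ∃ c ∈ 𝔹, ρ a (c ⊓ b)
  exists_below : ∀ a, a ≠ ⊥ → ∃ b ∈ 𝔹, b ≠ ⊥ ∧ NonTangential ρ b a

/-- The relation `ll` (written `≪` in the comments) makes the Boolean algebra `B` an
MVD-algebra. -/
structure IsMVD {B : Type u} [BooleanAlgebra B] (ll : B → B → Prop) : Prop where
  le_of_ll : ∀ a b, ll a b → a ≤ b
  bot_ll_bot : ll ⊥ ⊥
  mono : ∀ a b c t, a ≤ b → ll b c → c ≤ t → ll a t
  sup_ll : ∀ a b c, ll a c → ll b c → ll (a ⊔ b) c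
  ll_inf : ∀ a b c, ll a b → ll a c → ll a (b ⊓ c)
  interpolate : ∀ a c, ll a c → ∃ b, ll a b ∧ ll b c
  exists_below : ∀ a, a ≠ ⊥ → ∃ b, b ≠ ⊥ ∧ ll b a
  mvd : ∀ a b, ll a ⊤ → ll bᶜ aᶜ → ll a b

/-- Complete local contact algebras. The elements `0` and `1` may coincide. -/
structure CompleteLCA : Type (u + 1) where
  carrier : Type u
  [str : CompleteBooleanAlgebra carrier]
  rel : carrier → carrier → Prop
  bounded : Set carrier
  isLocalContact : IsLocalContact rel bounded

attribute [instance] CompleteLCA.str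

/-- Complete MVD-algebras. The elements `0` and `1` may coincide. -/
structure CompleteMVD : Type (u + 1) where
  carrier : Type u
  [str : CompleteBooleanAlgebra carrier]
  ll : carrier → carrier → Prop
  isMVD : IsMVD ll

attribute [instance] CompleteMVD.str

/-! ### The lower adjoint of a complete Boolean homomorphism

A complete Boolean homomorphism is a map that preserves all joins and all meets, that is, a
`CompleteLatticeHom` between complete Boolean algebras (it then preserves complements). -/

/-- The lower adjoint `φ_Λ` of `φ`; see `gc_lowerAdjoint`. -/
def lowerAdjoint {A B : Type u} [CompleteBooleanAlgebra A] [CompleteBooleanAlgebra B]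
    (φ : CompleteLatticeHom A B) (b : B) : A :=
  sInf {a | b ≤ φ a}

theorem gc_lowerAdjoint {A B : Type u} [CompleteBooleanAlgebra A] [CompleteBooleanAlgebra B]
    (φ : CompleteLatticeHom A B) : GaloisConnection (lowerAdjoint φ) φ := by
  intro b a
  constructor
  · intro h
    have h1 : b ≤ φ (lowerAdjoint φ b) := by
      unfold lowerAdjoint
      rw [map_sInf]
      refine le_sInf ?_
      rintro _ ⟨c, hc, rfl⟩
      exact hc
    exact h1.trans (OrderHomClass.mono φ h)
  · intro h
    exact sInf_le h

theorem lowerAdjoint_id {A : Type u} [CompleteBooleanAlgebra A] (a : A) :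
    lowerAdjoint (CompleteLatticeHom.id A) a = a :=
  eq_of_forall_ge_iff fun c => gc_lowerAdjoint (CompleteLatticeHom.id A) a c

theorem lowerAdjoint_comp {A B C : Type u} [CompleteBooleanAlgebra A]
    [CompleteBooleanAlgebra B] [CompleteBooleanAlgebra C]
    (ψ : CompleteLatticeHom B C) (φ : CompleteLatticeHom A B) (c : C) :
    lowerAdjoint (ψ.comp φ) c = lowerAdjoint φ (lowerAdjoint ψ c) :=
  eq_of_forall_ge_iff fun a =>
    (gc_lowerAdjoint (ψ.comp φ) c a).trans
      ((gc_lowerAdjoint φ _ a).trans (gc_lowerAdjoint ψ c (φ a))).symm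

/-! ### The category `SOAL` -/

/-- The objects of `SOAL` are the complete local contact algebras. -/
def SOAL : Type (u + 1) := CompleteLCA.{u}

/-- The morphisms of `SOAL` are the surjective complete Boolean homomorphisms that satisfy
(L1), (L2) and (LO). -/
@[ext]
structure SOALHom (A B : CompleteLCA.{u}) : Type u where
  hom : CompleteLatticeHom A.carrier B.carrier
  surjective : Function.Surjective hom
  L1 : ∀ a b, B.rel (hom a) (hom b) → A.rel a b
  L2 : ∀ b, b ∈ B.bounded → lowerAdjoint hom b ∈ A.bounded
  LO : ∀ a b, b ∈ B.bounded → A.rel (lowerAdjoint hom b) a → B.rel b (hom a)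

/-- The identity morphism. -/
def SOALHom.id (A : CompleteLCA.{u}) : SOALHom A A where
  hom := CompleteLatticeHom.id A.carrier
  surjective := Function.surjective_id
  L1 := fun _ _ h => h
  L2 := fun b h => by rw [lowerAdjoint_id]; exact h
  LO := fun a b _ h => by rw [lowerAdjoint_id] at h; exact h

/-- Composition of functions: first `φ`, then `ψ`. -/
def SOALHom.comp {A B C : CompleteLCA.{u}} (φ : SOALHom A B) (ψ : SOALHom B C) :
    SOALHom A C where
  hom := ψ.hom.comp φ.hom
  surjective := ψ.surjective.comp φ.surjective
  L1 := fun a b h => φ.L1 a b (ψ.L1 _ _ h)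
  L2 := fun c h => by rw [lowerAdjoint_comp]; exact φ.L2 _ (ψ.L2 c h)
  LO := fun a c hc h => by
    rw [lowerAdjoint_comp] at h
    exact ψ.LO _ c hc (φ.LO a _ (ψ.L2 c hc) h)

instance SOAL.category : Category.{u} SOAL.{u} where
  Hom A B := SOALHom A B
  id A := SOALHom.id A
  comp φ ψ := SOALHom.comp φ ψ
  id_comp _ := rfl
  comp_id _ := rfl
  assoc _ _ _ := rfl

/-! ### The category `ISOAL` -/

/-- The objects of `ISOAL` are the complete MVD-algebras. -/
def ISOAL : Type (u + 1) := CompleteMVD.{u}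

/-- The morphisms of `ISOAL` are the surjective complete Boolean homomorphisms that satisfy
(S1), (S2) and (SO). -/
@[ext]
structure ISOALHom (A B : CompleteMVD.{u}) : Type u where
  hom : CompleteLatticeHom A.carrier B.carrier
  surjective : Function.Surjective hom
  S1 : ∀ a b, (∀ c, A.ll c ⊤ → A.ll (c ⊓ a) (cᶜ ⊔ b)) →
    ∀ d, B.ll d ⊤ → B.ll (d ⊓ hom a) (dᶜ ⊔ hom b)
  S2 : ∀ b, B.ll b ⊤ → A.ll (lowerAdjoint hom b) ⊤
  SO : ∀ a b, B.ll b (hom a) → A.ll (lowerAdjoint hom b) a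

/-- The identity morphism. -/
def ISOALHom.id (A : CompleteMVD.{u}) : ISOALHom A A where
  hom := CompleteLatticeHom.id A.carrier
  surjective := Function.surjective_id
  S1 := fun _ _ h => h
  S2 := fun b h => by rw [lowerAdjoint_id]; exact h
  SO := fun a b h => by rw [lowerAdjoint_id]; exact h

/-- Composition of functions: first `φ`, then `ψ`. -/
def ISOALHom.comp {A B C : CompleteMVD.{u}} (φ : ISOALHom A B) (ψ : ISOALHom B C) :
    ISOALHom A C where
  hom := ψ.hom.comp φ.hom
  surjective := ψ.surjective.comp φ.surjective
  S1 := fun a b h => ψ.S1 _ _ (φ.S1 a b h)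
  S2 := fun c h => by rw [lowerAdjoint_comp]; exact φ.S2 _ (ψ.S2 c h)
  SO := fun a c h => by rw [lowerAdjoint_comp]; exact φ.SO a _ (ψ.SO _ c h)

instance ISOAL.category : Category.{u} ISOAL.{u} where
  Hom A B := ISOALHom A B
  id A := ISOALHom.id A
  comp φ ψ := ISOALHom.comp φ ψ
  id_comp _ := rfl
  comp_id _ := rfl
  assoc _ _ _ := rfl

/-! ### The category `IOLC` -/

/-- The objects of `IOLC` are the locally compact Hausdorff spaces. -/
structure IOLC : Type (u + 1) where
  carrier : Type u
  [top : TopologicalSpace carrier]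
  [locallyCompact : LocallyCompactSpace carrier]
  [hausdorff : T2Space carrier]

attribute [instance] IOLC.top IOLC.locallyCompact IOLC.hausdorff

/-- The morphisms of `IOLC` are the injective open maps (open maps are continuous). -/
@[ext]
structure IOLCHom (X Y : IOLC.{u}) : Type u where
  map : C(X.carrier, Y.carrier)
  injective : Function.Injective map
  isOpenMap : IsOpenMap map

/-- The identity morphism. -/
def IOLCHom.id (X : IOLC.{u}) : IOLCHom X X where
  map := ContinuousMap.id X.carrier
  injective := Function.injective_id
  isOpenMap := IsOpenMap.id

/-- Composition of functions: first `f`, then `g`. -/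
def IOLCHom.comp {X Y Z : IOLC.{u}} (f : IOLCHom X Y) (g : IOLCHom Y Z) : IOLCHom X Z where
  map := g.map.comp f.map
  injective := g.injective.comp f.injective
  isOpenMap := g.isOpenMap.comp f.isOpenMap

instance IOLC.category : Category.{u} IOLC.{u} where
  Hom X Y := IOLCHom X Y
  id X := IOLCHom.id X
  comp f g := IOLCHom.comp f g
  id_comp _ := rfl
  comp_id _ := rfl
  assoc _ _ _ := rfl

/-! ### Local contact algebras and MVD-algebras determine each other -/

section Translation

variable {B : Type u} [BooleanAlgebra B]

/-! A local contact algebra and an MVD-algebra carry the same data on one Boolean algebra. Given `ρ`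
and the bounded elements, let `a ≪ b` mean that `a` is bounded and `a ≪_ρ b`; boundedness is then `a
≪ 1`. Conversely, contact is always witnessed by bounded parts, so `a ≪_ρ b` holds iff `c ⊓ a ≪ cᶜ ⊔
b` for every bounded `c` (`localLL_boundedLL`, `boundedLL_localContact`). Under this translation
(L1), (L2), (LO) become (S1), (S2), (SO), which gives mutually inverse functors that fix carriers
and maps.

The duality is proved directly on `ISOAL`. Each MVD-algebra is the algebra of regular open sets of
its space of points, and `a ≪ b` says that the closure of `a` is compact and contained in `b`
(`ll_iff`). A morphism pulls points back: surjectivity makes this map injective, and (SO) makes it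
open. An open continuous injection comes from the morphism taking preimages of regular open sets
(`exists_isoalHom_comap_eq`), and every locally compact Hausdorff space is the space of points of
its regular open sets (`pointOf_surjective`). -/

theorem IsContactRelation.mono {C : B → B → Prop} (hC : IsContactRelation C) {a b c d : B}
    (hac : a ≤ c) (hbd : b ≤ d) (h : C a b) : C c d := by
  have right : ∀ {x y z : B}, y ≤ z → C x y → C x z := fun {x y z} hyz hxy => by
    rw [← sup_eq_right.2 hyz]
    exact (hC.sup_iff _ _ _).2 (Or.inl hxy)
  exact hC.symm _ _ (right hac (hC.symm _ _ (right hbd h)))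

theorem NonTangential.le {C : B → B → Prop} (hC : IsContactRelation C) {a b : B}
    (h : NonTangential C a b) : a ≤ b := by
  by_contra hab
  have hne : a ⊓ bᶜ ≠ ⊥ := fun h0 =>
    hab (disjoint_compl_right_iff.1 (disjoint_iff.2 h0))
  exact h (hC.mono inf_le_left inf_le_right (hC.refl_of_ne_bot _ hne))

/-- The MVD-relation of a local contact algebra. -/
def boundedLL (ρ : B → B → Prop) (𝔹 : Set B) (a b : B) : Prop :=
  a ∈ 𝔹 ∧ NonTangential ρ a b

theorem boundedLL_top {ρ : B → B → Prop} {𝔹 : Set B} (h : IsLocalContact ρ 𝔹) (a : B) :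
    boundedLL ρ 𝔹 a ⊤ ↔ a ∈ 𝔹 := by
  refine ⟨And.left, fun ha => ⟨ha, fun hr => ?_⟩⟩
  exact (h.contact.ne_bot _ _ hr).2 compl_top

theorem IsLocalContact.isMVD {ρ : B → B → Prop} {𝔹 : Set B} (h : IsLocalContact ρ 𝔹) :
    IsMVD (boundedLL ρ 𝔹) where
  le_of_ll _ _ hab := hab.2.le h.contact
  bot_ll_bot := ⟨h.bot_mem, fun hr => (h.contact.ne_bot _ _ hr).1 rfl⟩
  mono a b c t hab hbc hct := ⟨h.mem_of_le _ _ hab hbc.1, fun hr =>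
    hbc.2 (h.contact.mono hab (compl_le_compl hct) hr)⟩
  sup_ll a b c ha hb := ⟨h.sup_mem _ _ ha.1 hb.1, fun hr => by
    rcases (h.contact.sup_iff _ _ _).1 (h.contact.symm _ _ hr) with hr | hr
    · exact ha.2 (h.contact.symm _ _ hr)
    · exact hb.2 (h.contact.symm _ _ hr)⟩
  ll_inf a b c hb hc := ⟨hb.1, fun hr => by
    rw [compl_inf] at hr
    exact ((h.contact.sup_iff _ _ _).1 hr).elim hb.2 hc.2⟩
  interpolate a c hac := by
    obtain ⟨b, hb, hab, hbc⟩ := h.interpolate a c hac.1 hac.2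
    exact ⟨b, ⟨hac.1, hab⟩, ⟨hb, hbc⟩⟩
  exists_below a ha := by
    obtain ⟨b, hb, hb0, hba⟩ := h.exists_below a ha
    exact ⟨b, hb0, hb, hba⟩
  mvd a b ha hba := ⟨ha.1, fun hr => hba.2 (by rw [compl_compl]; exact h.contact.symm _ _ hr)⟩

/-- The non-tangential inclusion of an MVD-algebra. -/
def localLL (ll : B → B → Prop) (a b : B) : Prop :=
  ∀ c, ll c ⊤ → ll (c ⊓ a) (cᶜ ⊔ b)

/-- The contact relation of an MVD-algebra. -/
def localContact (ll : B → B → Prop) (a b : B) : Prop :=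
  ¬ localLL ll a bᶜ

theorem nonTangential_localContact (ll : B → B → Prop) (a b : B) :
    NonTangential (localContact ll) a b ↔ localLL ll a b := by
  rw [NonTangential, localContact, not_not, compl_compl]

theorem IsMVD.ll_top {ll : B → B → Prop} (h : IsMVD ll) {a b : B} (hab : ll a b) : ll a ⊤ :=
  h.mono _ _ _ _ le_rfl hab le_top

theorem IsMVD.localLL_of_ll {ll : B → B → Prop} (h : IsMVD ll) {a b : B} (hab : ll a b) :
    localLL ll a b :=
  fun _ _ => h.mono _ _ _ _ inf_le_right hab le_sup_right

/-- A bounded `c` with `a ≪ c` loses nothing: `c ⊓ a = a`, and `c ⊓ (cᶜ ⊔ b) ≤ b`. -/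
theorem IsMVD.ll_of_localLL {ll : B → B → Prop} (h : IsMVD ll) {a b : B} (ha : ll a ⊤)
    (hab : localLL ll a b) : ll a b := by
  obtain ⟨c, hac, hc⟩ := h.interpolate _ _ ha
  refine h.mono _ _ _ _ (le_inf (h.le_of_ll _ _ hac) le_rfl)
    (h.ll_inf _ _ _ (h.mono _ _ _ _ inf_le_right hac le_rfl) (hab c hc)) ?_
  rw [inf_sup_left, inf_compl_self, bot_sup_eq]
  exact inf_le_right

/-- This is the symmetry of the contact relation. The axiom `mvd` applies because `c ⊓ bᶜ` is
bounded. -/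
theorem IsMVD.localLL_compl {ll : B → B → Prop} (h : IsMVD ll) {a b : B}
    (hab : localLL ll a b) : localLL ll bᶜ aᶜ := fun c hc => by
  refine h.mvd _ _ (h.mono _ _ _ _ inf_le_left hc le_rfl) ?_
  have := hab c hc
  simpa only [compl_inf, compl_sup, compl_compl] using this

theorem IsMVD.bounded_sup {ll : B → B → Prop} (h : IsMVD ll) {a b : B} (ha : ll a ⊤)
    (hb : ll b ⊤) : ll (a ⊔ b) ⊤ :=
  h.sup_ll _ _ _ ha hb

theorem localLL_mono {ll : B → B → Prop} (h : IsMVD ll) {a b c d : B} (hab : a ≤ b)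
    (hbc : localLL ll b c) (hcd : c ≤ d) : localLL ll a d :=
  fun e he => h.mono _ _ _ _ (inf_le_inf_left _ hab) (hbc e he) (sup_le_sup_left hcd _)

theorem IsMVD.isContactRelation {ll : B → B → Prop} (h : IsMVD ll) :
    IsContactRelation (localContact ll) where
  refl_of_ne_bot a ha hl := by
    obtain ⟨b, hb, hba⟩ := h.exists_below a ha
    -- Testing `localLL` of `a` and `aᶜ` at the bounded element `b ≤ a` gives `b ≤ bᶜ`.
    have h1 := h.le_of_ll _ _ (hl b (h.ll_top hba))
    rw [inf_eq_left.2 (h.le_of_ll _ _ hba), ← compl_inf, inf_eq_left.2 (h.le_of_ll _ _ hba)] at h1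
    exact hb (le_compl_self.1 h1)
  ne_bot a b hab := by
    constructor <;> rintro rfl <;> refine hab fun c hc => ?_
    · rw [inf_bot_eq]
      exact h.mono _ _ _ _ le_rfl h.bot_ll_bot bot_le
    · rw [compl_bot, sup_top_eq]
      exact h.mono _ _ _ _ inf_le_left hc le_rfl
  symm a b hab hba := hab (by simpa only [compl_compl] using h.localLL_compl hba)
  sup_iff a b c := by
    simp only [localContact]
    rw [← not_and_or, not_iff_not, compl_sup]
    refine ⟨fun hl => ⟨localLL_mono h le_rfl hl inf_le_left,
      localLL_mono h le_rfl hl inf_le_right⟩, fun hl d hd => ?_⟩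
    rw [sup_inf_left]
    exact h.ll_inf _ _ _ (hl.1 d hd) (hl.2 d hd)

theorem IsMVD.isLocalContact {ll : B → B → Prop} (h : IsMVD ll) :
    IsLocalContact (localContact ll) {a | ll a ⊤} where
  contact := h.isContactRelation
  bot_mem := h.ll_top h.bot_ll_bot
  mem_of_le _ _ hab hb := h.mono _ _ _ _ hab hb le_rfl
  sup_mem _ _ ha hb := h.bounded_sup ha hb
  interpolate a c ha hac := by
    rw [nonTangential_localContact] at hac
    obtain ⟨b, hab, hbc⟩ := h.interpolate _ _ (h.ll_of_localLL ha hac)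
    refine ⟨b, h.ll_top hbc, ?_, ?_⟩ <;> rw [nonTangential_localContact]
    exacts [h.localLL_of_ll hab, h.localLL_of_ll hbc]
  contact_bounded a b hab := by
    by_contra! hc
    -- Each bounded `c` is used both as the cutting element and as the test element.
    refine hab fun c hcb => ?_
    have := not_not.1 (hc c hcb) c hcb
    rwa [compl_inf, sup_left_idem] at this
  exists_below a ha := by
    obtain ⟨b, hb, hba⟩ := h.exists_below a ha
    exact ⟨b, h.ll_top hba, hb, (nonTangential_localContact _ _ _).2 (h.localLL_of_ll hba)⟩

theorem IsMVD.boundedLL_localContact {ll : B → B → Prop} (h : IsMVD ll) :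
    boundedLL (localContact ll) {a | ll a ⊤} = ll := by
  ext a b
  rw [boundedLL, nonTangential_localContact]
  exact ⟨fun hab => h.ll_of_localLL hab.1 hab.2, fun hab => ⟨h.ll_top hab, h.localLL_of_ll hab⟩⟩

theorem IsLocalContact.localLL_boundedLL {ρ : B → B → Prop} {𝔹 : Set B}
    (h : IsLocalContact ρ 𝔹) (a b : B) :
    localLL (boundedLL ρ 𝔹) a b ↔ NonTangential ρ a b := by
  constructor
  · intro hl hr
    -- Both sides of the contact are cut down to bounded parts, and `c ⊔ d` serves as the single
    -- test element.
    obtain ⟨c, hc, hr⟩ := h.contact_bounded _ _ hr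
    obtain ⟨d, hd, hr⟩ := h.contact_bounded _ _ (h.contact.symm _ _ hr)
    refine (hl (c ⊔ d) ((boundedLL_top h _).2 (h.sup_mem _ _ hc hd))).2 ?_
    rw [compl_sup, compl_compl]
    exact h.contact.mono (inf_le_inf_right _ le_sup_right) (inf_le_inf_right _ le_sup_left)
      (h.contact.symm _ _ hr)
  · intro hab c hc
    refine ⟨h.mem_of_le _ _ inf_le_left hc.1, fun hr => hab ?_⟩
    exact h.contact.mono inf_le_right (compl_le_compl le_sup_right) hr

theorem IsLocalContact.localContact_boundedLL {ρ : B → B → Prop} {𝔹 : Set B}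
    (h : IsLocalContact ρ 𝔹) : localContact (boundedLL ρ 𝔹) = ρ := by
  ext a b
  rw [localContact, h.localLL_boundedLL, NonTangential, not_not, compl_compl]

theorem IsLocalContact.setOf_boundedLL_top {ρ : B → B → Prop} {𝔹 : Set B}
    (h : IsLocalContact ρ 𝔹) : {a | boundedLL ρ 𝔹 a ⊤} = 𝔹 :=
  Set.ext (boundedLL_top h)

end Translation

/-! ### The isomorphism of `SOAL` and `ISOAL` -/

/-- The MVD-algebra of a local contact algebra. -/
def CompleteLCA.toMVD (A : CompleteLCA.{u}) : CompleteMVD.{u} where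
  carrier := A.carrier
  ll := boundedLL A.rel A.bounded
  isMVD := A.isLocalContact.isMVD

/-- The local contact algebra of an MVD-algebra. -/
def CompleteMVD.toLCA (A : CompleteMVD.{u}) : CompleteLCA.{u} where
  carrier := A.carrier
  rel := localContact A.ll
  bounded := {a | A.ll a ⊤}
  isLocalContact := A.isMVD.isLocalContact

theorem CompleteLCA.toLCA_toMVD (A : CompleteLCA.{u}) : A.toMVD.toLCA = A := by
  obtain ⟨α, ρ, 𝔹, h⟩ := A
  simp only [CompleteMVD.toLCA, CompleteLCA.toMVD]
  congr
  · exact h.localContact_boundedLL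
  · exact h.setOf_boundedLL_top

theorem CompleteMVD.toMVD_toLCA (A : CompleteMVD.{u}) : A.toLCA.toMVD = A := by
  obtain ⟨α, ll, h⟩ := A
  simp only [CompleteMVD.toLCA, CompleteLCA.toMVD]
  congr
  exact h.boundedLL_localContact

theorem CompleteLatticeHom.map_compl {A B : Type u} [CompleteBooleanAlgebra A]
    [CompleteBooleanAlgebra B] (φ : CompleteLatticeHom A B) (a : A) : φ aᶜ = (φ a)ᶜ :=
  map_compl' φ a

/-- A morphism of local contact algebras is a morphism of the associated MVD-algebras. -/
def SOALHom.toMVD {A B : CompleteLCA.{u}} (φ : SOALHom A B) : ISOALHom A.toMVD B.toMVD where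
  hom := φ.hom
  surjective := φ.surjective
  S1 a b hab := by
    -- (S1) is the contrapositive of (L1) at `a` and `bᶜ`; likewise (SO) below is (LO) at `aᶜ`.
    refine (B.isLocalContact.localLL_boundedLL (φ.hom a) (φ.hom b)).2 fun hr => ?_
    exact (A.isLocalContact.localLL_boundedLL a b).1 hab
      (φ.L1 _ _ ((φ.hom.map_compl b).symm ▸ hr))
  S2 b hb := (boundedLL_top A.isLocalContact _).2 (φ.L2 b hb.1)
  SO a b hb := ⟨φ.L2 b hb.1, fun hr => hb.2 (φ.hom.map_compl a ▸ φ.LO _ b hb.1 hr)⟩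

/-- A morphism of MVD-algebras is a morphism of the associated local contact algebras. -/
def ISOALHom.toLCA {A B : CompleteMVD.{u}} (φ : ISOALHom A B) : SOALHom A.toLCA B.toLCA where
  hom := φ.hom
  surjective := φ.surjective
  L1 _ b hab hl := hab (φ.hom.map_compl b ▸ φ.S1 _ _ hl)
  L2 b hb := φ.S2 b hb
  LO a _ hb hr hl := hr (A.isMVD.localLL_of_ll (φ.SO _ _
    ((φ.hom.map_compl a).symm ▸ B.isMVD.ll_of_localLL hb hl)))

/-- The round trips fix objects only up to a propositional equality, so morphisms are compared
heterogeneously through their underlying homomorphisms, which are unchanged. -/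
theorem SOALHom.heq_of_hom_heq {A A' B B' : CompleteLCA.{u}} (hA : A = A') (hB : B = B')
    (f : SOALHom A B) (g : SOALHom A' B') (h : HEq f.hom g.hom) : HEq f g := by
  subst hA hB
  exact _root_.heq_of_eq (SOALHom.ext (eq_of_heq h))

theorem ISOALHom.heq_of_hom_heq {A A' B B' : CompleteMVD.{u}} (hA : A = A') (hB : B = B')
    (f : ISOALHom A B) (g : ISOALHom A' B') (h : HEq f.hom g.hom) : HEq f g := by
  subst hA hB
  exact _root_.heq_of_eq (ISOALHom.ext (eq_of_heq h))

/-- The functor from local contact algebras to MVD-algebras. -/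
def soalToISOAL : SOAL.{u} ⥤ ISOAL.{u} where
  obj A := CompleteLCA.toMVD A
  map φ := SOALHom.toMVD φ
  map_id _ := rfl
  map_comp _ _ := rfl

/-- The functor from MVD-algebras to local contact algebras. -/
def isoalToSOAL : ISOAL.{u} ⥤ SOAL.{u} where
  obj A := CompleteMVD.toLCA A
  map φ := ISOALHom.toLCA φ
  map_id _ := rfl
  map_comp _ _ := rfl

theorem soalToISOAL_comp_isoalToSOAL : soalToISOAL.{u} ⋙ isoalToSOAL = 𝟭 SOAL.{u} :=
  Functor.hext CompleteLCA.toLCA_toMVD fun A B _ =>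
    SOALHom.heq_of_hom_heq (CompleteLCA.toLCA_toMVD A) (CompleteLCA.toLCA_toMVD B) _ _ HEq.rfl

theorem isoalToSOAL_comp_soalToISOAL : isoalToSOAL.{u} ⋙ soalToISOAL = 𝟭 ISOAL.{u} :=
  Functor.hext CompleteMVD.toMVD_toLCA fun A B _ =>
    ISOALHom.heq_of_hom_heq (CompleteMVD.toMVD_toLCA A) (CompleteMVD.toMVD_toLCA B) _ _ HEq.rfl

/-! ### The space of points of an MVD-algebra -/

open Set Topology

/-- A point of an MVD-algebra: a proper round filter that decides every instance of `≪`. -/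
@[ext]
structure CompleteMVD.Point (A : CompleteMVD.{u}) : Type u where
  carrier : Set A.carrier
  top_mem' : ⊤ ∈ carrier
  bot_notMem' : ⊥ ∉ carrier
  mem_of_le' : ∀ a b, a ≤ b → a ∈ carrier → b ∈ carrier
  inf_mem' : ∀ a b, a ∈ carrier → b ∈ carrier → a ⊓ b ∈ carrier
  round' : ∀ a ∈ carrier, ∃ b ∈ carrier, A.ll b a
  decides' : ∀ a b, A.ll a b → aᶜ ∈ carrier ∨ b ∈ carrier

namespace CompleteMVD

variable {A : CompleteMVD.{u}}

namespace Point

instance : SetLike A.Point A.carrier where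
  coe := carrier
  coe_injective _ _ h := Point.ext h

variable (F : A.Point) {a b : A.carrier}

theorem top_mem : ⊤ ∈ F := F.top_mem'

theorem bot_notMem : ⊥ ∉ F := F.bot_notMem'

variable {F} in
theorem mem_of_le (ha : a ∈ F) (hab : a ≤ b) : b ∈ F := F.mem_of_le' _ _ hab ha

variable {F} in
theorem inf_mem (ha : a ∈ F) (hb : b ∈ F) : a ⊓ b ∈ F := F.inf_mem' _ _ ha hb

variable {F} in
theorem exists_ll (ha : a ∈ F) : ∃ b ∈ F, A.ll b a := F.round' a ha

theorem compl_mem_or_mem (h : A.ll a b) : aᶜ ∈ F ∨ b ∈ F := F.decides' a b h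

variable {F} in
theorem compl_notMem (ha : a ∈ F) : aᶜ ∉ F := fun h =>
  F.bot_notMem (inf_compl_self a ▸ inf_mem ha h)

theorem exists_bounded : ∃ c ∈ F, A.ll c ⊤ := exists_ll F.top_mem

theorem inf_mem_iff : a ⊓ b ∈ F ↔ a ∈ F ∧ b ∈ F :=
  ⟨fun h => ⟨mem_of_le h inf_le_left, mem_of_le h inf_le_right⟩, fun h => inf_mem h.1 h.2⟩

variable {F} in
theorem mem_of_sup_mem (ha : a ∈ F) (h : aᶜ ⊔ b ∈ F) : b ∈ F :=
  mem_of_le (inf_mem ha h) (by rw [inf_sup_left, inf_compl_self, bot_sup_eq]; exact inf_le_right)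

variable {F} in
theorem compl_mem_of_inf_compl_mem (ha : a ∈ F) (h : (a ⊓ b)ᶜ ∈ F) : bᶜ ∈ F :=
  mem_of_sup_mem ha (compl_inf (x := a) (y := b) ▸ h)

variable {F} in
-- For `b ≪ a` with `b ∈ G`, deciding in `F` leaves only `a ∈ F`, since `bᶜ ∈ F ⊆ G` would clash
-- with `b`.
theorem eq_of_le {G : A.Point} (h : ∀ a ∈ F, a ∈ G) : F = G := by
  refine SetLike.ext fun a => ⟨h a, fun ha => ?_⟩
  obtain ⟨b, hb, hba⟩ := exists_ll ha
  exact (F.compl_mem_or_mem hba).resolve_left fun hb' => compl_notMem hb (h _ hb')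

/-- The open set of points that contain `a`. -/
def basicOpen (a : A.carrier) : Set A.Point := {F | a ∈ F}

instance : TopologicalSpace A.Point := TopologicalSpace.generateFrom (range basicOpen)

theorem basicOpen_inf : basicOpen (a ⊓ b) = basicOpen a ∩ basicOpen b :=
  Set.ext fun F => F.inf_mem_iff

theorem basicOpen_mono (h : a ≤ b) : basicOpen a ⊆ basicOpen b := fun _ hF => mem_of_le hF h

theorem basicOpen_bot : basicOpen (⊥ : A.carrier) = ∅ :=
  eq_empty_of_forall_notMem fun F => F.bot_notMem

theorem isTopologicalBasis_basicOpen :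
    TopologicalSpace.IsTopologicalBasis (range (basicOpen (A := A))) where
  exists_subset_inter := by
    rintro _ ⟨a, rfl⟩ _ ⟨b, rfl⟩ F hF
    exact ⟨_, ⟨a ⊓ b, rfl⟩, basicOpen_inf ▸ hF, basicOpen_inf.subset⟩
  sUnion_eq := eq_univ_of_forall fun F => ⟨_, ⟨⊤, rfl⟩, F.top_mem⟩
  eq_generateFrom := rfl

theorem isOpen_basicOpen (a : A.carrier) : IsOpen (basicOpen a) :=
  isTopologicalBasis_basicOpen.isOpen ⟨a, rfl⟩

theorem exists_basicOpen_subset {V : Set A.Point} (hV : IsOpen V) {F : A.Point} (hF : F ∈ V) :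
    ∃ a ∈ F, basicOpen a ⊆ V := by
  obtain ⟨_, ⟨a, rfl⟩, ha, h⟩ := isTopologicalBasis_basicOpen.exists_subset_of_mem_open hF hV
  exact ⟨a, ha, h⟩

instance : T2Space A.Point where
  t2 F G hne := by
    obtain ⟨a, haF, haG⟩ : ∃ a ∈ F, a ∉ G := by
      by_contra! h
      exact hne (eq_of_le h)
    obtain ⟨b, hbF, hba⟩ := exists_ll haF
    refine ⟨_, _, isOpen_basicOpen b, isOpen_basicOpen bᶜ, hbF,
      (G.compl_mem_or_mem hba).resolve_right haG, ?_⟩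
    rw [disjoint_iff_inter_eq_empty, ← basicOpen_inf, inf_compl_self, basicOpen_bot]

/-- A proper family `p` that is closed under meets, has a bounded element and decides every
instance of `≪` generates a point: the elements `a` with `b ≪ a` for some `b` in `p`. -/
def ofPrime (p : A.carrier → Prop) (hbot : ¬ p ⊥) (hinf : ∀ a b, p a → p b → p (a ⊓ b))
    (hbdd : ∃ c, A.ll c ⊤ ∧ p c) (hdec : ∀ a b, A.ll a b → p aᶜ ∨ p b) : A.Point where
  carrier := {a | ∃ b, A.ll b a ∧ p b}
  top_mem' := hbdd
  bot_notMem' := by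
    rintro ⟨b, hb, hp⟩
    exact hbot (le_bot_iff.1 (A.isMVD.le_of_ll _ _ hb) ▸ hp)
  mem_of_le' := by
    rintro a b hab ⟨c, hca, hc⟩
    exact ⟨c, A.isMVD.mono _ _ _ _ le_rfl hca hab, hc⟩
  inf_mem' := by
    rintro a b ⟨c, hca, hc⟩ ⟨d, hdb, hd⟩
    exact ⟨c ⊓ d, A.isMVD.ll_inf _ _ _ (A.isMVD.mono _ _ _ _ inf_le_left hca le_rfl)
      (A.isMVD.mono _ _ _ _ inf_le_right hdb le_rfl), hinf _ _ hc hd⟩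
  round' := by
    rintro a ⟨b, hba, hb⟩
    obtain ⟨c, hbc, hca⟩ := A.isMVD.interpolate _ _ hba
    exact ⟨c, ⟨b, hbc, hb⟩, hca⟩
  decides' a b hab := by
    obtain ⟨c, hac, hcb⟩ := A.isMVD.interpolate _ _ hab
    obtain ⟨d, hcd, hdb⟩ := A.isMVD.interpolate _ _ hcb
    refine (hdec c d hcd).imp (fun hc => ?_) fun hd => ⟨d, hdb, hd⟩
    -- `cᶜ` need not be bounded, so it is cut by a bounded `e` to make `mvd` applicable.
    obtain ⟨e, he, hpe⟩ := hbdd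
    refine ⟨e ⊓ cᶜ, A.isMVD.mvd _ _ (A.isMVD.mono _ _ _ _ inf_le_left he le_rfl) ?_,
      hinf _ _ hpe hc⟩
    refine A.isMVD.mono _ _ _ _ (compl_compl a).le hac ?_
    rw [compl_inf, compl_compl]
    exact le_sup_right

/-- A prime ideal avoiding some nonzero `b ≪ a` has an ultrafilter as complement; the bounded `b` in
it lets `ofPrime` produce a point. -/
theorem exists_mem_of_ne_bot (ha : a ≠ ⊥) : ∃ F : A.Point, a ∈ F := by
  obtain ⟨b, hb, hba⟩ := A.isMVD.exists_below a ha
  obtain ⟨J, hJ, -, hdis⟩ := DistribLattice.prime_ideal_of_disjoint_filter_ideal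
    (F := Order.PFilter.principal b) (I := (⊥ : Order.Ideal A.carrier)) (by
      rw [Set.disjoint_left]
      intro x hx hx'
      have h1 : b ≤ x := hx
      have h2 : x ≤ ⊥ := hx'
      exact hb (le_bot_iff.1 (h1.trans h2)))
  have hbJ : b ∉ J := fun h => Set.disjoint_left.1 hdis (Order.PFilter.mem_principal.2 le_rfl) h
  refine ⟨ofPrime (fun x => x ∉ J) (not_not.2 J.bot_mem)
    (fun x y hx hy h => (hJ.mem_or_mem h).elim hx hy) ⟨b, A.isMVD.ll_top hba, hbJ⟩
    (fun x y hxy => ?_), b, hba, hbJ⟩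
  by_contra! h
  refine hbJ (J.lower le_top ?_ : b ∈ J)
  have := J.sup_mem h.1 h.2
  rwa [eq_top_iff.2 (compl_sup_eq_top.symm.trans_le (sup_le_sup_left
    (A.isMVD.le_of_ll _ _ hxy) _))] at this

theorem basicOpen_nonempty (ha : a ≠ ⊥) : (basicOpen a).Nonempty := exists_mem_of_ne_bot ha

/-! ### Elements as regular open sets of points -/

theorem basicOpen_subset_iff : basicOpen a ⊆ basicOpen b ↔ a ≤ b := by
  refine ⟨fun h => ?_, basicOpen_mono⟩
  by_contra hab
  obtain ⟨F, hF⟩ := exists_mem_of_ne_bot (a := a ⊓ bᶜ)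
    fun h0 => hab (disjoint_compl_right_iff.1 (disjoint_iff.2 h0))
  rw [inf_mem_iff] at hF
  exact compl_notMem (h hF.1) hF.2

theorem basicOpen_injective : Function.Injective (basicOpen (A := A)) := fun _ _ h =>
  le_antisymm (basicOpen_subset_iff.1 h.subset) (basicOpen_subset_iff.1 h.symm.subset)

theorem closure_basicOpen (a : A.carrier) : closure (basicOpen a) = (basicOpen aᶜ)ᶜ := by
  refine subset_antisymm (closure_minimal (fun F hF => compl_notMem hF)
    (isOpen_basicOpen _).isClosed_compl) fun F hF => ?_
  rw [isTopologicalBasis_basicOpen.mem_closure_iff]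
  rintro _ ⟨c, rfl⟩ hc
  rw [← basicOpen_inf]
  exact basicOpen_nonempty fun h0 => hF (mem_of_le hc (le_compl_iff_disjoint_right.2
    (disjoint_iff.2 h0)))

theorem mem_closure_basicOpen {F : A.Point} : F ∈ closure (basicOpen a) ↔ aᶜ ∉ F := by
  rw [closure_basicOpen]
  rfl

theorem interior_closure_basicOpen (a : A.carrier) :
    interior (closure (basicOpen a)) = basicOpen a := by
  rw [closure_basicOpen, interior_compl, closure_basicOpen, compl_compl, compl_compl]

theorem exists_basicOpen_eq {V : Set A.Point} (hV : interior (closure V) = V) :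
    ∃ a, basicOpen a = V := by
  have hVo : IsOpen V := hV ▸ isOpen_interior
  refine ⟨sSup {b | basicOpen b ⊆ V}, subset_antisymm ?_ fun F hF => ?_⟩
  · refine (interior_maximal (fun F hF => ?_) (isOpen_basicOpen _)).trans hV.subset
    rw [isTopologicalBasis_basicOpen.mem_closure_iff]
    rintro _ ⟨c, rfl⟩ hc
    by_contra hne
    -- Infinite distributivity: an element disjoint from every `b` is disjoint from their join.
    have hd : Disjoint c (sSup {b | basicOpen b ⊆ V}) := by
      refine disjoint_sSup_iff.2 fun b hb => disjoint_iff.2 ?_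
      by_contra h0
      obtain ⟨G, hG⟩ := basicOpen_nonempty h0
      rw [basicOpen_inf] at hG
      exact hne ⟨G, hG.1, hb hG.2⟩
    exact F.bot_notMem (hd.eq_bot ▸ inf_mem hc hF)
  · obtain ⟨b, hb, hbV⟩ := exists_basicOpen_subset hVo hF
    exact mem_of_le hb (le_sSup hbV)

/-! ### The relation `≪` in topological terms -/

theorem closure_basicOpen_subset (h : A.ll a b) : closure (basicOpen a) ⊆ basicOpen b :=
  fun F hF => (F.compl_mem_or_mem h).resolve_left (mem_closure_basicOpen.1 hF)

/-- An ultrafilter `W` on the closure converges to the point generated by the elements whose basic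
open set lies in `W`; a bounded `c` with `a ≪ c` is one of them. -/
theorem isCompact_closure_basicOpen (ha : A.ll a ⊤) : IsCompact (closure (basicOpen a)) := by
  obtain ⟨c, hac, hc⟩ := A.isMVD.interpolate _ _ ha
  rw [isCompact_iff_ultrafilter_le_nhds]
  intro W hW
  have hcW : basicOpen c ∈ W :=
    Filter.mem_of_superset (Filter.le_principal_iff.1 hW) (closure_basicOpen_subset hac)
  let P : A.Point := ofPrime (fun b => basicOpen b ∈ W)
    (by rw [basicOpen_bot]; exact W.empty_notMem)
    (fun x y hx hy => basicOpen_inf ▸ Filter.inter_mem hx hy) ⟨c, hc, hcW⟩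
    (fun x y hxy => by
      refine or_iff_not_imp_right.2 fun hy => ?_
      rw [← Ultrafilter.compl_mem_iff_notMem] at hy
      exact Filter.mem_of_superset hy fun F hF => (F.compl_mem_or_mem hxy).resolve_right hF)
  have hP : (W : Filter A.Point) ≤ 𝓝 P := by
    intro V hV
    obtain ⟨V', hV', hVo, hPV⟩ := mem_nhds_iff.1 hV
    obtain ⟨b, ⟨d, hdb, hd⟩, hb⟩ := exists_basicOpen_subset hVo hPV
    exact Filter.mem_of_superset hd
      (((basicOpen_mono (A.isMVD.le_of_ll _ _ hdb)).trans hb).trans hV')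
  exact ⟨P, isClosed_closure.mem_of_tendsto hP (Filter.le_principal_iff.1 hW), hP⟩

theorem ll_iff : A.ll a b ↔ IsCompact (closure (basicOpen a)) ∧
    closure (basicOpen a) ⊆ basicOpen b := by
  refine ⟨fun h => ⟨isCompact_closure_basicOpen (A.isMVD.ll_top h), closure_basicOpen_subset h⟩,
    fun ⟨hK, hab⟩ => ?_⟩
  obtain ⟨c, hc, hcb⟩ : ∃ c, closure (basicOpen a) ⊆ basicOpen c ∧ A.ll c b := by
    -- Each point of the closure contains some `c ≪ b`; compactness leaves a finite join of these.
    refine hK.induction_on (p := fun s => ∃ c, s ⊆ basicOpen c ∧ A.ll c b)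
      ⟨⊥, empty_subset _, A.isMVD.mono _ _ _ _ le_rfl A.isMVD.bot_ll_bot bot_le⟩
      (fun s t hst ⟨c, hc, hcb⟩ => ⟨c, hst.trans hc, hcb⟩)
      (fun s t ⟨c, hc, hcb⟩ ⟨d, hd, hdb⟩ => ⟨c ⊔ d, union_subset
        (hc.trans (basicOpen_mono le_sup_left)) (hd.trans (basicOpen_mono le_sup_right)),
        A.isMVD.sup_ll _ _ _ hcb hdb⟩) fun F hF => ?_
    obtain ⟨c, hc, hcb⟩ := exists_ll (hab hF)
    exact ⟨_, mem_nhdsWithin_of_mem_nhds ((isOpen_basicOpen c).mem_nhds hc), c, subset_rfl, hcb⟩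
  exact A.isMVD.mono _ _ _ _ (basicOpen_subset_iff.1 (subset_closure.trans hc)) hcb le_rfl

theorem localLL_iff : localLL A.ll a b ↔ closure (basicOpen a) ⊆ basicOpen b := by
  constructor
  · intro h F hF
    obtain ⟨c, hc, hcb⟩ := F.exists_bounded
    refine mem_of_sup_mem hc ((F.compl_mem_or_mem (h c hcb)).resolve_left fun h' => ?_)
    exact mem_closure_basicOpen.1 hF (compl_mem_of_inf_compl_mem hc h')
  · intro h c hc
    refine ll_iff.2 ⟨(isCompact_closure_basicOpen hc).of_isClosed_subset isClosed_closure
      (closure_mono (basicOpen_mono inf_le_left)), ?_⟩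
    exact ((closure_mono (basicOpen_mono inf_le_right)).trans h).trans
      (basicOpen_mono le_sup_right)

instance : LocallyCompactSpace A.Point := by
  have : WeaklyLocallyCompactSpace A.Point := ⟨fun F => by
    obtain ⟨c, hc, hcb⟩ := F.exists_bounded
    exact ⟨_, isCompact_closure_basicOpen hcb,
      Filter.mem_of_superset ((isOpen_basicOpen c).mem_nhds hc) subset_closure⟩⟩
  infer_instance

end Point

end CompleteMVD

/-! ### The functor of points -/

open CompleteMVD.Point in
/-- The map on points induced by a morphism of MVD-algebras. -/
def ISOALHom.comap {A B : CompleteMVD.{u}} (φ : ISOALHom A B) (F : B.Point) : A.Point where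
  carrier := {a | φ.hom a ∈ F}
  top_mem' := mem_of_le F.top_mem (map_top φ.hom).ge
  bot_notMem' h := F.bot_notMem (mem_of_le h (map_bot φ.hom).le)
  mem_of_le' _ _ hab ha := mem_of_le ha (OrderHomClass.mono φ.hom hab)
  inf_mem' a b ha hb := mem_of_le (inf_mem ha hb) (map_inf φ.hom a b).ge
  round' a ha := by
    obtain ⟨b, hb, hba⟩ := exists_ll ha
    exact ⟨_, mem_of_le hb ((gc_lowerAdjoint φ.hom).le_u_l b), φ.SO _ _ hba⟩
  decides' a b hab := by
    -- (S1) yields only the local relation between the images, but that already decides every point.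
    have h := localLL_iff.1 (φ.S1 a b (A.isMVD.localLL_of_ll hab))
    change φ.hom aᶜ ∈ F ∨ φ.hom b ∈ F
    rw [φ.hom.map_compl, or_iff_not_imp_left, ← mem_closure_basicOpen]
    exact fun hF => h hF

namespace ISOALHom

open CompleteMVD CompleteMVD.Point

variable {A B : CompleteMVD.{u}} (φ : ISOALHom A B)

theorem mem_comap {F : B.Point} {a : A.carrier} : a ∈ φ.comap F ↔ φ.hom a ∈ F := Iff.rfl

theorem preimage_comap_basicOpen (a : A.carrier) :
    φ.comap ⁻¹' basicOpen a = basicOpen (φ.hom a) := rfl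

theorem continuous_comap : Continuous φ.comap := by
  refine continuous_generateFrom_iff.2 ?_
  rintro _ ⟨a, rfl⟩
  exact isOpen_basicOpen (φ.hom a)

theorem comap_injective : Function.Injective φ.comap := by
  refine fun F G h => SetLike.ext fun b => ?_
  obtain ⟨a, rfl⟩ := φ.surjective b
  rw [← mem_comap, h, mem_comap]

theorem basicOpen_lowerAdjoint_subset (b : B.carrier) :
    basicOpen (lowerAdjoint φ.hom b) ⊆ closure (φ.comap '' basicOpen b) := by
  intro G hG
  rw [isTopologicalBasis_basicOpen.mem_closure_iff]
  rintro _ ⟨c, rfl⟩ hc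
  by_contra hne
  have h1 : b ≤ φ.hom cᶜ := by
    rw [φ.hom.map_compl, le_compl_iff_disjoint_right, disjoint_iff]
    by_contra h0
    obtain ⟨F, hF⟩ := basicOpen_nonempty h0
    rw [basicOpen_inf] at hF
    exact hne ⟨φ.comap F, hF.2, F, hF.1, rfl⟩
  -- A neighbourhood `c` missing the image forces `b ≤ φ cᶜ`, hence the lower adjoint of `b` lies
  -- below `cᶜ`.
  exact compl_notMem hc (mem_of_le hG (gc_lowerAdjoint φ.hom _ _ |>.2 h1))

theorem isOpenMap_comap : IsOpenMap φ.comap := by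
  refine isTopologicalBasis_basicOpen.isOpenMap_iff.2 ?_
  rintro _ ⟨b, rfl⟩
  refine isOpen_iff_forall_mem_open.2 ?_
  rintro _ ⟨F, hF, rfl⟩
  obtain ⟨c, hc, hcb⟩ := exists_ll hF
  refine ⟨_, ?_, isOpen_basicOpen (lowerAdjoint φ.hom c),
    mem_of_le hc ((gc_lowerAdjoint φ.hom).le_u_l c)⟩
  -- Compactness makes the image of the closure of `c` closed, so it absorbs the closure of the
  -- image.
  obtain ⟨hK, hKb⟩ := ll_iff.1 hcb
  exact (φ.basicOpen_lowerAdjoint_subset c).trans ((closure_minimal (image_mono subset_closure)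
    (hK.image φ.continuous_comap).isClosed).trans (image_mono hKb))

theorem eq_of_comap_eq {φ ψ : ISOALHom A B} (h : φ.comap = ψ.comap) : φ = ψ := by
  refine ISOALHom.ext (CompleteLatticeHom.ext fun a => basicOpen_injective ?_)
  rw [← preimage_comap_basicOpen, h, preimage_comap_basicOpen]

end ISOALHom

/-- The space of points of an MVD-algebra as an object of `IOLC`. -/
def CompleteMVD.space (A : CompleteMVD.{u}) : IOLC.{u} where
  carrier := A.Point

/-- The morphism of `IOLC` induced by a morphism of MVD-algebras. -/
def ISOALHom.spaceMap {A B : CompleteMVD.{u}} (φ : ISOALHom A B) : IOLCHom B.space A.space where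
  map := ⟨φ.comap, φ.continuous_comap⟩
  injective := φ.comap_injective
  isOpenMap := φ.isOpenMap_comap

/-- The functor of points. -/
def pointsFunctor : ISOAL.{u} ⥤ IOLC.{u}ᵒᵖ where
  obj A := Opposite.op (CompleteMVD.space A)
  map φ := Quiver.Hom.op (V := IOLC) (ISOALHom.spaceMap φ)
  map_id _ := rfl
  map_comp _ _ := rfl

instance : pointsFunctor.{u}.Faithful where
  map_injective {A B} φ ψ h := by
    have h1 : ISOALHom.spaceMap φ = ISOALHom.spaceMap ψ := congrArg Quiver.Hom.unop h
    have h2 : ISOALHom.comap φ = ISOALHom.comap ψ :=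
      congrArg (fun f : IOLCHom _ _ => (f.map : _ → _)) h1
    exact ISOALHom.eq_of_comap_eq h2

/-! ### Open injections between spaces of points come from morphisms -/

section Full

open CompleteMVD CompleteMVD.Point

variable {A B : CompleteMVD.{u}} {f : B.Point → A.Point}

theorem exists_basicOpen_eq_preimage (hc : Continuous f) (ho : IsOpenMap f) (a : A.carrier) :
    ∃ b : B.carrier, basicOpen b = f ⁻¹' basicOpen a := by
  refine exists_basicOpen_eq ?_
  rw [← ho.preimage_closure_eq_closure_preimage hc,
    ← ho.preimage_interior_eq_interior_preimage hc, interior_closure_basicOpen]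

theorem exists_basicOpen_eq_interior_closure_image (f : B.Point → A.Point) (b : B.carrier) :
    ∃ a : A.carrier, basicOpen a = interior (closure (f '' basicOpen b)) :=
  exists_basicOpen_eq (by rw [interior_closure_idem])

/-- A map that preserves complements and has a lower adjoint is a complete homomorphism. -/
def completeLatticeHomOfAdjoint {α β : Type u} [CompleteBooleanAlgebra α]
    [CompleteBooleanAlgebra β] (g : α → β) (l : β → α) (hgl : GaloisConnection l g)
    (hg : ∀ a, g aᶜ = (g a)ᶜ) : CompleteLatticeHom α β where
  toFun := g
  map_sInf' s := by rw [hgl.u_sInf, sInf_image]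
  map_sSup' s := by
    rw [← compl_inj_iff, ← hg, compl_sSup', hgl.u_sInf, compl_sSup', ← sInf_image]
    congr 1
    ext b
    simp only [mem_image, exists_exists_and_eq_and, hg]

/-- For `f` open and continuous, preimage commutes with closure and interior, so it preserves
regular open sets and complements. Its lower adjoint sends `b` to the interior of the closure of the
image. -/
theorem exists_isoalHom_comap_eq (hc : Continuous f) (ho : IsOpenMap f)
    (hi : Function.Injective f) : ∃ φ : ISOALHom A B, φ.comap = f := by
  choose g hg using exists_basicOpen_eq_preimage hc ho
  choose l hl using exists_basicOpen_eq_interior_closure_image f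
  have gc : GaloisConnection l g := by
    intro b a
    rw [← basicOpen_subset_iff, ← basicOpen_subset_iff, hl, hg, ← image_subset_iff]
    refine ⟨fun h => (interior_maximal subset_closure (ho _ (isOpen_basicOpen b))).trans h,
      fun h => ?_⟩
    rw [← interior_closure_basicOpen a]
    exact interior_mono (closure_mono h)
  have hcompl : ∀ a, g aᶜ = (g a)ᶜ := fun a => basicOpen_injective <| by
    rw [hg, ← compl_inj_iff, ← preimage_compl, ← closure_basicOpen, ← closure_basicOpen, hg,
      ho.preimage_closure_eq_closure_preimage hc]
  let φ := completeLatticeHomOfAdjoint g l gc hcompl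
  have hφl : ∀ b, lowerAdjoint φ b = l b := fun b =>
    eq_of_forall_ge_iff fun a => (gc_lowerAdjoint φ b a).trans (gc b a).symm
  have hSO : ∀ a b, B.ll b (φ a) → A.ll (lowerAdjoint φ b) a := by
    intro a b hba
    obtain ⟨hK, hba⟩ := ll_iff.1 hba
    have hKf := hK.image hc
    have hsub : closure (basicOpen (lowerAdjoint φ b)) ⊆ f '' closure (basicOpen b) := by
      rw [hφl, hl]
      exact closure_minimal (interior_subset.trans (closure_minimal (image_mono subset_closure)
        hKf.isClosed)) hKf.isClosed
    refine ll_iff.2 ⟨hKf.of_isClosed_subset isClosed_closure hsub, hsub.trans ?_⟩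
    rw [image_subset_iff, ← hg]
    exact hba
  refine ⟨⟨φ, fun b => ⟨l b, basicOpen_injective ?_⟩, fun a b hab => ?_, fun b hb => ?_, hSO⟩, ?_⟩
  -- Injectivity of `f` gives `g (l b) = b`, hence surjectivity of `g`.
  · change basicOpen (g (l b)) = _
    rw [hg, hl, ho.preimage_interior_eq_interior_preimage hc,
      ho.preimage_closure_eq_closure_preimage hc, preimage_image_eq _ hi,
      interior_closure_basicOpen]
  · refine localLL_iff.2 ?_
    change closure (basicOpen (g a)) ⊆ basicOpen (g b)
    rw [hg, hg, ← ho.preimage_closure_eq_closure_preimage hc]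
    exact preimage_mono (localLL_iff.1 hab)
  · exact hSO ⊤ b ((map_top φ).symm ▸ hb)
  · refine funext fun F => SetLike.ext fun a => ?_
    exact Set.ext_iff.1 (hg a) F

end Full

instance : pointsFunctor.{u}.Full where
  map_surjective {A B} f := by
    let f' : IOLCHom (CompleteMVD.space B) (CompleteMVD.space A) := f.unop
    obtain ⟨φ, hφ⟩ := exists_isoalHom_comap_eq (A := A) (B := B) (f := f'.map) f'.map.continuous
      f'.isOpenMap f'.injective
    refine ⟨φ, Quiver.Hom.unop_inj ?_⟩
    exact IOLCHom.ext (ContinuousMap.ext fun F => congrFun hφ F)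

/-! ### The MVD-algebra of regular open sets -/

open TopologicalSpace in
/-- The regular open subsets of a topological space. -/
abbrev RegularOpens (X : Type u) [TopologicalSpace X] : Type u := Heyting.Regular (Opens X)

namespace RegularOpens

open TopologicalSpace

variable {X : Type u} [TopologicalSpace X]

instance : CompleteBooleanAlgebra (RegularOpens X) :=
  { (inferInstance : BooleanAlgebra (RegularOpens X)) with
    sSup := fun s => Heyting.Regular.toRegular (sSup (Heyting.Regular.val '' s))
    sInf := fun s => Heyting.Regular.toRegular (sInf (Heyting.Regular.val '' s))
    isLUB_sSup := fun _ => Heyting.Regular.gi.isLUB_of_u_image (isLUB_sSup _)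
    isGLB_sInf := fun _ => Heyting.Regular.gi.isGLB_of_u_image (isGLB_sInf _) }

/-- The underlying set of a regular open set. -/
def toSet (U : RegularOpens X) : Set X := (U.val : Opens X)

theorem isOpen (U : RegularOpens X) : IsOpen U.toSet := U.val.isOpen

theorem toSet_subset {U V : RegularOpens X} : U.toSet ⊆ V.toSet ↔ U ≤ V := Iff.rfl

theorem toSet_injective : Function.Injective (toSet (X := X)) := fun _ _ h =>
  le_antisymm (toSet_subset.1 h.subset) (toSet_subset.1 h.symm.subset)

theorem toSet_bot : (⊥ : RegularOpens X).toSet = ∅ := rfl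

theorem toSet_inf (U V : RegularOpens X) : (U ⊓ V).toSet = U.toSet ∩ V.toSet := rfl

theorem toSet_compl (U : RegularOpens X) : Uᶜ.toSet = (closure U.toSet)ᶜ := by
  rw [← interior_compl]
  exact Opens.coe_compl_eq_interior_compl

theorem closure_toSet_sup (U V : RegularOpens X) :
    closure (U ⊔ V).toSet = closure U.toSet ∪ closure V.toSet := by
  rw [← compl_inj_iff, ← toSet_compl, compl_sup, compl_union, ← toSet_compl, ← toSet_compl]
  exact toSet_inf _ _

theorem closure_toSet_compl (U : RegularOpens X) : closure Uᶜ.toSet = U.toSetᶜ := by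
  rw [← compl_inj_iff, ← toSet_compl, compl_compl, compl_compl]

/-- The regularization `int (cl s)` of a set. -/
def regularize (s : Set X) : RegularOpens X :=
  ⟨⟨interior (closure s), isOpen_interior⟩, Opens.ext <| by
    rw [Opens.coe_compl_eq_interior_compl, Opens.coe_compl_eq_interior_compl, Opens.coe_mk,
      interior_compl, interior_compl, closure_compl, compl_compl, interior_closure_idem]⟩

theorem subset_regularize {s : Set X} (hs : IsOpen s) : s ⊆ (regularize s).toSet :=
  interior_maximal subset_closure hs

theorem closure_regularize_subset (s : Set X) : closure (regularize s).toSet ⊆ closure s :=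
  closure_minimal interior_subset isClosed_closure

/-- `U ≪ V` if the closure of `U` is a compact subset of `V`. -/
def LL (U V : RegularOpens X) : Prop := IsCompact (closure U.toSet) ∧ closure U.toSet ⊆ V.toSet

variable [LocallyCompactSpace X] [T2Space X]

theorem exists_between {K V : Set X} (hK : IsCompact K) (hV : IsOpen V) (hKV : K ⊆ V) :
    ∃ U : RegularOpens X, K ⊆ U.toSet ∧ IsCompact (closure U.toSet) ∧ closure U.toSet ⊆ V := by
  obtain ⟨W, hW, hKW, hWV, hWc⟩ := exists_open_between_and_isCompact_closure hK hV hKV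
  exact ⟨regularize W, hKW.trans (subset_regularize hW),
    hWc.of_isClosed_subset isClosed_closure (closure_regularize_subset W),
    (closure_regularize_subset W).trans hWV⟩

theorem exists_mem_between {x : X} {V : Set X} (hV : IsOpen V) (hx : x ∈ V) :
    ∃ U : RegularOpens X, x ∈ U.toSet ∧ IsCompact (closure U.toSet) ∧ closure U.toSet ⊆ V := by
  obtain ⟨U, hU, h⟩ := exists_between isCompact_singleton hV (singleton_subset_iff.2 hx)
  exact ⟨U, hU rfl, h⟩

theorem isMVD : IsMVD (LL (X := X)) where
  le_of_ll _ _ h := toSet_subset.1 (subset_closure.trans h.2)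
  bot_ll_bot := by simp [LL, toSet_bot]
  mono a b c t hab hbc hct := by
    have h := closure_mono (toSet_subset.2 hab)
    exact ⟨hbc.1.of_isClosed_subset isClosed_closure h, (h.trans hbc.2).trans (toSet_subset.2 hct)⟩
  sup_ll a b c ha hb := by
    rw [LL, closure_toSet_sup]
    exact ⟨ha.1.union hb.1, union_subset ha.2 hb.2⟩
  ll_inf a b c hb hc := ⟨hb.1, subset_inter hb.2 hc.2⟩
  interpolate a c h := by
    obtain ⟨b, hab, hb, hbc⟩ := exists_between h.1 c.isOpen h.2
    exact ⟨b, ⟨h.1, hab⟩, hb, hbc⟩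
  exists_below a ha := by
    obtain ⟨x, hx⟩ := nonempty_iff_ne_empty.2 fun h => ha (toSet_injective (h.trans toSet_bot.symm))
    obtain ⟨b, hxb, hb, hba⟩ := exists_mem_between a.isOpen hx
    exact ⟨b, by rintro rfl; exact hxb, hb, hba⟩
  mvd a b ha h := by
    have h1 := h.2
    rw [closure_toSet_compl, toSet_compl, compl_subset_compl] at h1
    exact ⟨ha.1, h1⟩

end RegularOpens

/-- The MVD-algebra of regular open subsets of a locally compact Hausdorff space. -/
def IOLC.regularOpens (X : IOLC.{u}) : CompleteMVD.{u} where
  carrier := RegularOpens X.carrier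
  ll := RegularOpens.LL
  isMVD := RegularOpens.isMVD

namespace IOLC

open RegularOpens CompleteMVD.Point

variable (X : IOLC.{u})

/-- The regular open neighbourhoods of a point. -/
def pointOf (x : X.carrier) : X.regularOpens.Point where
  carrier := {U | x ∈ toSet U}
  top_mem' := mem_univ x
  bot_notMem' := notMem_empty x
  mem_of_le' _ _ hab ha := toSet_subset.2 hab ha
  inf_mem' _ _ ha hb := ⟨ha, hb⟩
  round' a ha := exists_mem_between (isOpen a) ha
  decides' a b hab := by
    refine or_iff_not_imp_left.2 fun h => hab.2 ?_
    by_contra hx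
    exact h ((toSet_compl a).ge hx)

theorem mem_pointOf {x : X.carrier} {U : RegularOpens X.carrier} :
    U ∈ X.pointOf x ↔ x ∈ U.toSet := Iff.rfl

theorem continuous_pointOf : Continuous X.pointOf := by
  refine continuous_generateFrom_iff.2 ?_
  rintro _ ⟨U, rfl⟩
  exact isOpen U

theorem pointOf_injective : Function.Injective X.pointOf := by
  intro x y h
  by_contra hne
  obtain ⟨U, hxU, -, hU⟩ := exists_mem_between (isOpen_compl_singleton (x := y)) hne
  have hyU : y ∈ U.toSet := by rwa [← mem_pointOf, ← h]
  exact hU (subset_closure hyU) rfl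

/-- The closures of members of `P` with compact closure are directed, so they share a point `x`.
Roundness puts `x` in every member of `P`, and `eq_of_le` turns this inclusion into equality. -/
theorem pointOf_surjective : Function.Surjective X.pointOf := by
  intro P
  obtain ⟨c₀, hc₀, hb₀⟩ := P.exists_bounded
  obtain ⟨x, hx⟩ := IsCompact.nonempty_iInter_of_directed_nonempty_isCompact_isClosed
    (ι := {c : RegularOpens X.carrier // c ∈ P ∧ IsCompact (closure c.toSet)})
    (hι := ⟨c₀, hc₀, hb₀.1⟩) (fun c => closure c.1.toSet)
    (fun c d => ⟨⟨c.1 ⊓ d.1, inf_mem c.2.1 d.2.1, c.2.2.of_isClosed_subset isClosed_closure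
      (closure_mono inter_subset_left)⟩, closure_mono inter_subset_left,
      closure_mono inter_subset_right⟩)
    (fun c => closure_nonempty_iff.2 (nonempty_iff_ne_empty.2 fun h =>
      P.bot_notMem (toSet_injective (h.trans toSet_bot.symm) ▸ c.2.1)))
    (fun c => c.2.2) (fun c => isClosed_closure)
  refine ⟨x, (eq_of_le fun U hU => ?_).symm⟩
  obtain ⟨V, hV, hVU⟩ := exists_ll hU
  exact hVU.2 (mem_iInter.1 hx ⟨V, hV, hVU.1⟩)

theorem isOpenMap_pointOf : IsOpenMap X.pointOf := by
  intro V hV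
  refine isOpen_iff_forall_mem_open.2 ?_
  rintro _ ⟨x, hx, rfl⟩
  obtain ⟨U, hxU, -, hUV⟩ := exists_mem_between hV hx
  refine ⟨basicOpen (A := X.regularOpens) U, fun P hP => ?_, isOpen_basicOpen _, hxU⟩
  obtain ⟨y, rfl⟩ := X.pointOf_surjective P
  exact ⟨y, hUV (subset_closure hP), rfl⟩

/-- A locally compact Hausdorff space is the space of points of its regular open sets. -/
noncomputable def pointsHomeomorph : X.carrier ≃ₜ X.regularOpens.Point :=
  (Equiv.ofBijective X.pointOf ⟨X.pointOf_injective, X.pointOf_surjective⟩).toHomeomorphOfContinuousOpen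
    X.continuous_pointOf X.isOpenMap_pointOf

/-- A homeomorphism is an isomorphism of `IOLC`. -/
def isoOfHomeomorph {X Y : IOLC.{u}} (e : X.carrier ≃ₜ Y.carrier) : X ≅ Y where
  hom := { map := e, injective := e.injective, isOpenMap := e.isOpenMap : IOLCHom X Y }
  inv := { map := e.symm, injective := e.symm.injective, isOpenMap := e.symm.isOpenMap :
    IOLCHom Y X }
  hom_inv_id := IOLCHom.ext (ContinuousMap.ext e.symm_apply_apply)
  inv_hom_id := IOLCHom.ext (ContinuousMap.ext e.apply_symm_apply)

end IOLC

instance : pointsFunctor.{u}.EssSurj where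
  mem_essImage X :=
    ⟨X.unop.regularOpens, ⟨(IOLC.isoOfHomeomorph X.unop.pointsHomeomorph).op⟩⟩

instance : pointsFunctor.{u}.IsEquivalence where

theorem mainTheorem11 :
    (∃ (K : SOAL.{u} ⥤ ISOAL.{u}) (Θ : ISOAL.{u} ⥤ SOAL.{u}),
      K ⋙ Θ = 𝟭 SOAL.{u} ∧ Θ ⋙ K = 𝟭 ISOAL.{u}) ∧
    Nonempty (IOLC.{u}ᵒᵖ ≌ ISOAL.{u}) :=
  ⟨⟨soalToISOAL, isoalToSOAL, soalToISOAL_comp_isoalToSOAL, isoalToSOAL_comp_soalToISOAL⟩,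
    ⟨pointsFunctor.asEquivalence.symm⟩⟩
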